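/- For $d,m\ge 1$ let $F_d(m)$ be the number of even primitive Dirichlet characters of order $d$ and conductor $m$. For $r\in\mathbb{R}$ and $g:[r,\infty)\to\mathbb{R}_{>0}$ put $$S_d(g;X):=\sum_{\substack{m\ge 1\\ r\le m\le X}}F_d(m)\,g(m).$$ For functions $u,v$ that are positive for all large $X$, write $u(X)\sim v(X)$ if $\lim_{X\to\infty}u(X)/v(X)$ exists and is nonzero (the limit need not be $1$). **Lemma.** Let $r\in\mathbb{R}$ and let $g:[r,\infty)\to\mathbb{R}_{>0}$ be decreasing (not necessarily strictly), continuously differentiable, and such that $-g'(X)\ll g(X)/X$ as $X\to\infty$. Then for every prime $p$ there is a constant $C>0$, depending only on $p$ and $g$ (with its domain $[r,\infty)$), such that $$S_p(g;X)\le C\sum_{\substack{m\in\mathbb{Z}\\ r\le m\le X}}g(m)\quad\text{for all } X\ge r,$$ and $$\sum_{\substack{m\in\mathbb{Z}\\ r\le m\le X}}g(m)\;\sim\;\int_r^X g(t)\,dt .$$ -/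

import Mathlib

open Filter Topology Asymptotics

noncomputable section

/-- `evenPrimCount d m` is the number of even primitive Dirichlet characters of order `d`
and conductor `m` (that is, primitive at level `m`), for `m ≥ 1`. -/
def evenPrimCount (d m : ℕ) : ℕ :=
  Set.ncard {χ : DirichletCharacter ℂ m | χ.Even ∧ χ.IsPrimitive ∧ orderOf χ = d}

/-- The sum of `evenPrimCount d m * g m` over all positive integers `m` with `r ≤ m ≤ X`. -/
def charSum (d : ℕ) (r : ℝ) (g : ℝ → ℝ) (X : ℝ) : ℝ :=
  ∑ m ∈ Finset.Icc (max 1 ⌈r⌉₊) ⌊X⌋₊, (evenPrimCount d m : ℝ) * g m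

/-- The sum of `g m` over all integers `m` with `r ≤ m ≤ X`. -/
def intSum (r : ℝ) (g : ℝ → ℝ) (X : ℝ) : ℝ :=
  ∑ m ∈ Finset.Icc ⌈r⌉ ⌊X⌋, g m

/-- The ratio `u X / v X` has a limit as `X → ∞`, and this limit is nonzero (it need not
be `1`). -/
def AsympProportional (u v : ℝ → ℝ) : Prop :=
  ∃ c : ℝ, c ≠ 0 ∧ Tendsto (fun X => u X / v X) atTop (𝓝 c)

end

/-! The mean value of `evenPrimCount p` is bounded by comparison with ideals of
$\mathbb{Q}(\zeta_p)$. Primitive characters killed by $p$ are submultiplicative in the level. At a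
prime $q \ne p$ there are at most $p-1$ of them, and none unless $q \equiv 1 \pmod p$, when $q$
splits into $p-1$ primes of norm $q$; at $q^k$ with $k \ge 2$ there are none. Hence away from $p$
they are at most as many as the ideals of norm $m$ (`ncard_primitiveTorsion_le_idealCount`), while
the $p$-part costs a factor $p^2$. Ideals of norm at most $n$ number $O(n)$, so
`exists_sum_evenPrimCount_le` gives a linear bound, and Abel summation against the decreasing $g$
yields the first claim. For the second, sum and integral differ by at most $2g(r)$: if the integral
diverges the ratio tends to 1, otherwise both converge to positive limits. -/

/-! ### Torsion characters and generators of unit groups. -/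

theorem MulChar.ncard_pow_eq_one_le {M : Type*} [CommMonoid M] (T : Finset Mˣ)
    (hT : Subgroup.closure (T : Set Mˣ) = ⊤) {n : ℕ} (hn : 0 < n) :
    {χ : MulChar M ℂ | χ ^ n = 1}.ncard ≤ n ^ T.card := by
  classical
  let S : Finset (T → ℂ) := Fintype.piFinset fun _ => Polynomial.nthRootsFinset n (1 : ℂ)
  have hS : S.card ≤ n ^ T.card := by
    simp only [S, Fintype.card_piFinset, Finset.prod_const, Finset.card_univ, Fintype.card_coe]
    refine Nat.pow_le_pow_left ?_ _
    exact (Multiset.toFinset_card_le _).trans (Polynomial.card_nthRoots n 1)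
  refine le_trans ?_ hS
  rw [← Set.ncard_coe_finset S]
  refine Set.ncard_le_ncard_of_injOn (fun χ t => χ (t : Mˣ)) ?_ ?_ S.finite_toSet
  · intro χ hχ
    simp only [S, Finset.mem_coe, Fintype.mem_piFinset, Polynomial.mem_nthRootsFinset hn]
    intro t
    have hχ' : χ ^ n = 1 := hχ
    rw [← MulChar.pow_apply_coe, hχ', MulChar.one_apply_coe]
  · intro χ _ ψ _ h
    have h2 : χ.toUnitHom = ψ.toUnitHom := by
      refine MonoidHom.eq_of_eqOn_dense hT fun t ht => Units.ext ?_
      simpa using congrFun h ⟨t, ht⟩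
    exact MulChar.equivToUnitHom.injective h2

theorem MulChar.ncard_pow_eq_one_le_of_isCyclic {M : Type*} [CommMonoid M] [IsCyclic Mˣ]
    {n : ℕ} (hn : 0 < n) : {χ : MulChar M ℂ | χ ^ n = 1}.ncard ≤ n := by
  obtain ⟨g, hg⟩ := IsCyclic.exists_generator (α := Mˣ)
  have := MulChar.ncard_pow_eq_one_le (M := M) {g} (n := n) ?_ hn
  · simpa using this
  · rw [Finset.coe_singleton, ← Subgroup.zpowers_eq_closure, Subgroup.eq_top_iff']
    exact hg

/-- The powers of 5 have index 2 and are all 1 mod 4, so adjoining $-1$ gives everything. -/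
theorem ZMod.closure_neg_one_five (n : ℕ) (u : (ZMod (2 ^ (n + 2)))ˣ)
    (hu : (u : ZMod (2 ^ (n + 2))) = 5) :
    Subgroup.closure ({-1, u} : Set (ZMod (2 ^ (n + 2)))ˣ) = ⊤ := by
  set H := Subgroup.closure ({-1, u} : Set (ZMod (2 ^ (n + 2)))ˣ)
  have hle : Subgroup.zpowers u ≤ H := by
    rw [Subgroup.zpowers_eq_closure]
    exact Subgroup.closure_mono (by simp)
  have hcz : Nat.card (Subgroup.zpowers u) = 2 ^ n := by
    rw [Nat.card_zpowers, ← orderOf_units, hu, ZMod.orderOf_five]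
  have hneg : (-1 : (ZMod (2 ^ (n + 2)))ˣ) ∉ Subgroup.zpowers u := by
    have h4 : 4 ∣ 2 ^ (n + 2) := ⟨2 ^ n, by ring⟩
    have hker : Subgroup.zpowers u ≤ (ZMod.unitsMap h4).ker := by
      rw [Subgroup.zpowers_le, MonoidHom.mem_ker, Units.ext_iff, ZMod.unitsMap_val, hu]
      have : ((5 : ℕ) : ZMod (2 ^ (n + 2))).cast = ((5 : ℕ) : ZMod 4) := ZMod.cast_natCast h4 5
      simp only [Nat.cast_ofNat] at this
      rw [this]; rfl
    intro h
    have := hker h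
    rw [MonoidHom.mem_ker, Units.ext_iff, ZMod.unitsMap_val] at this
    have h1 : (((-1 : ℤ) : ZMod (2 ^ (n + 2))).cast : ZMod 4) = ((-1 : ℤ) : ZMod 4) :=
      ZMod.cast_intCast h4 (-1)
    simp only [Int.cast_neg, Int.cast_one] at h1
    rw [Units.val_neg, Units.val_one, h1] at this
    exact absurd this (by decide)
  have hcard : Nat.card (ZMod (2 ^ (n + 2)))ˣ = 2 ^ (n + 1) := by
    rw [Nat.card_eq_fintype_card, ZMod.card_units_eq_totient,
      Nat.totient_prime_pow_succ Nat.prime_two]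
    simp
  have hd1 : Nat.card H ∣ 2 ^ (n + 1) := hcard ▸ Subgroup.card_subgroup_dvd_card H
  have hlt : 2 ^ n < Nat.card H := by
    rw [← hcz]
    by_contra hcon
    have := Subgroup.eq_of_le_of_card_ge hle (not_lt.mp hcon)
    exact hneg (this ▸ Subgroup.subset_closure (by simp))
  obtain ⟨j, hj, hj'⟩ := (Nat.dvd_prime_pow Nat.prime_two).mp hd1
  have : n < j := by
    rw [hj'] at hlt
    exact (Nat.pow_lt_pow_iff_right (by norm_num)).mp hlt
  have hjn : j = n + 1 := by omega
  exact Subgroup.eq_top_of_card_eq H (by rw [hj', hjn, hcard])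

/-! ### Primitive $p$-torsion characters at prime powers. -/

namespace DirichletCharacter

/-- The primitive Dirichlet characters of level `m` whose `p`-th power is trivial. -/
def primitiveTorsion (p m : ℕ) : Set (DirichletCharacter ℂ m) :=
  {χ | χ.IsPrimitive ∧ χ ^ p = 1}

theorem ncard_pow_eq_one_prime_pow_le {p : ℕ} (hp : p.Prime) (e : ℕ) :
    {χ : DirichletCharacter ℂ (p ^ e) | χ ^ p = 1}.ncard ≤ p ^ 2 := by
  have cyc : IsCyclic (ZMod (p ^ e))ˣ →
      {χ : DirichletCharacter ℂ (p ^ e) | χ ^ p = 1}.ncard ≤ p ^ 2 := fun h =>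
    (MulChar.ncard_pow_eq_one_le_of_isCyclic hp.pos).trans (Nat.le_self_pow (by norm_num) p)
  rcases eq_or_ne p 2 with rfl | h2
  · rcases le_or_gt e 2 with he | he
    · exact cyc ((ZMod.isCyclic_units_two_pow_iff e).mpr he)
    · obtain ⟨n, rfl⟩ : ∃ n, e = n + 2 := ⟨e - 2, by omega⟩
      have h5 : Nat.Coprime 5 (2 ^ (n + 2)) := Nat.Coprime.pow_right _ (by norm_num)
      refine (MulChar.ncard_pow_eq_one_le {-1, ZMod.unitOfCoprime 5 h5} ?_ hp.pos).trans ?_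
      · rw [Finset.coe_insert, Finset.coe_singleton]
        exact ZMod.closure_neg_one_five n _ (by simp)
      · exact Nat.pow_le_pow_right (by norm_num) Finset.card_le_two
  · exact cyc (ZMod.isCyclic_units_of_prime_pow p hp h2 e)

theorem ncard_primitiveTorsion_prime_pow_self_le {p : ℕ} (hp : p.Prime) (e : ℕ) :
    (primitiveTorsion p (p ^ e)).ncard ≤ p ^ 2 := by
  have : NeZero (p ^ e) := ⟨pow_ne_zero _ hp.ne_zero⟩
  exact (Set.ncard_le_ncard (fun χ hχ => hχ.2) (Set.toFinite _)).trans
    (ncard_pow_eq_one_prime_pow_le hp e)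

/-- The kernel of reduction to level $q$ is a $q$-group, on which a character of exponent $p$ is
trivial; so the conductor divides $q$. -/
theorem primitiveTorsion_prime_pow_eq_empty {p q k : ℕ} (hp : p.Prime) (hq : q.Prime)
    (hpq : p ≠ q) (hk : 2 ≤ k) : primitiveTorsion p (q ^ k) = ∅ := by
  have : NeZero (q ^ k) := ⟨pow_ne_zero _ hq.ne_zero⟩
  have : Fact q.Prime := ⟨hq⟩
  refine Set.eq_empty_of_forall_notMem fun χ ⟨hprim, hχ⟩ => ?_
  have hd : q ∣ q ^ k := dvd_pow_self q (by omega)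
  have hcard : Nat.card (ZMod.unitsMap hd).ker = q ^ (k - 1) := by
    have h1 := Subgroup.card_mul_index (ZMod.unitsMap hd).ker
    rw [Subgroup.index_ker, MonoidHom.range_eq_top.mpr (ZMod.unitsMap_surjective hd),
      Subgroup.card_top, Nat.card_eq_fintype_card (α := (ZMod q)ˣ),
      Nat.card_eq_fintype_card (α := (ZMod (q ^ k))ˣ), ZMod.card_units_eq_totient,
      ZMod.card_units_eq_totient, Nat.totient_prime_pow hq (by omega),
      Nat.totient_prime hq] at h1
    exact Nat.eq_of_mul_eq_mul_right (Nat.sub_pos_of_lt hq.one_lt) h1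
  have hf : χ.FactorsThrough q := by
    rw [factorsThrough_iff_ker_unitsMap hd]
    intro x hx
    rw [MonoidHom.mem_ker]
    have h1 : x ^ q ^ (k - 1) = 1 := by
      have := pow_card_eq_one' (x := (⟨x, hx⟩ : (ZMod.unitsMap hd).ker))
      rw [hcard] at this
      simpa [Subtype.ext_iff] using this
    have h2 : χ.toUnitHom x ^ q ^ (k - 1) = 1 := by rw [← map_pow, h1, map_one]
    have h3 : χ.toUnitHom x ^ p = 1 := by
      apply Units.ext
      rw [Units.val_pow_eq_pow_val, MulChar.coe_toUnitHom, ← MulChar.pow_apply_coe, hχ,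
        MulChar.one_apply_coe, Units.val_one]
    have h4 := pow_gcd_eq_one.mpr ⟨h3, h2⟩
    have : Nat.gcd p (q ^ (k - 1)) = 1 :=
      Nat.Coprime.pow_right _ ((Nat.coprime_primes hp hq).mpr hpq)
    rwa [this, pow_one] at h4
  have h := conductor_dvd_of_mem_conductorSet χ hf
  rw [(isPrimitive_def _).mp hprim] at h
  have := Nat.le_of_dvd hq.pos h
  have h' : q ^ 1 < q ^ k := Nat.pow_lt_pow_right hq.one_lt (by omega)
  rw [pow_one] at h'
  omega

theorem one_notMem_primitiveTorsion (p : ℕ) {q : ℕ} (hq : q ≠ 1) [NeZero q] :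
    1 ∉ primitiveTorsion p q := fun h => by
  have := h.1
  rw [isPrimitive_def, conductor_one] at this
  exact hq this.symm

theorem primitiveTorsion_prime_eq_empty {p q : ℕ} (hp : p.Prime) (hq : q.Prime)
    (hpq : ¬ p ∣ q - 1) : primitiveTorsion p q = ∅ := by
  have : Fact q.Prime := ⟨hq⟩
  refine Set.eq_empty_of_forall_notMem fun χ hχ => ?_
  suffices χ = 1 from one_notMem_primitiveTorsion p hq.ne_one (this ▸ hχ)
  have h1 : χ ^ (q - 1) = 1 := by
    rw [← ZMod.card_units q]
    exact χ.pow_card_eq_one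
  have h2 := pow_gcd_eq_one.mpr ⟨hχ.2, h1⟩
  rwa [(Nat.Prime.coprime_iff_not_dvd hp).mpr hpq, pow_one] at h2

theorem ncard_primitiveTorsion_prime_le {p q : ℕ} (hp : p.Prime) (hq : q.Prime) :
    (primitiveTorsion p q).ncard ≤ p - 1 := by
  have : Fact q.Prime := ⟨hq⟩
  have h : insert 1 (primitiveTorsion p q) ⊆ {χ : DirichletCharacter ℂ q | χ ^ p = 1} := by
    rintro χ (rfl | hχ)
    · exact one_pow p
    · exact hχ.2
  have h1 := Set.ncard_le_ncard h (Set.toFinite _)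
  rw [Set.ncard_insert_of_notMem (one_notMem_primitiveTorsion p hq.ne_one) (Set.toFinite _)] at h1
  have h2 : {χ : DirichletCharacter ℂ q | χ ^ p = 1}.ncard ≤ p :=
    MulChar.ncard_pow_eq_one_le_of_isCyclic hp.pos
  omega

/-! ### Splitting characters over coprime levels. -/

section Coprime

variable {a b : ℕ}

/-- The inclusion `u ↦ (u, 1)` of `(ZMod a)ˣ` into `(ZMod (a * b))ˣ`. -/
noncomputable def unitsInl (h : a.Coprime b) : (ZMod a)ˣ →* (ZMod (a * b))ˣ :=
  (Units.map (ZMod.chineseRemainder h).symm.toMonoidHom).comp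
    (MulEquiv.prodUnits.symm.toMonoidHom.comp (MonoidHom.inl _ _))

/-- The inclusion `u ↦ (1, u)` of `(ZMod b)ˣ` into `(ZMod (a * b))ˣ`. -/
noncomputable def unitsInr (h : a.Coprime b) : (ZMod b)ˣ →* (ZMod (a * b))ˣ :=
  (Units.map (ZMod.chineseRemainder h).symm.toMonoidHom).comp
    (MulEquiv.prodUnits.symm.toMonoidHom.comp (MonoidHom.inr _ _))

theorem unitsInl_mul_unitsInr (h : a.Coprime b) (u : (ZMod (a * b))ˣ) :
    unitsInl h (ZMod.unitsMap (Nat.dvd_mul_right a b) u) *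
      unitsInr h (ZMod.unitsMap (Nat.dvd_mul_left b a) u) = u := by
  refine Units.ext ((ZMod.chineseRemainder h).injective ?_)
  rw [Units.val_mul, map_mul]
  have h1 : (ZMod.chineseRemainder h) (unitsInl h (ZMod.unitsMap (Nat.dvd_mul_right a b) u)) =
      ((u : ZMod (a * b)).cast, 1) := by
    refine ((ZMod.chineseRemainder h).apply_symm_apply _).trans ?_
    rfl
  have h2 : (ZMod.chineseRemainder h) (unitsInr h (ZMod.unitsMap (Nat.dvd_mul_left b a) u)) =
      (1, (u : ZMod (a * b)).cast) := by
    refine ((ZMod.chineseRemainder h).apply_symm_apply _).trans ?_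
    rfl
  rw [h1, h2, Prod.mk_mul_mk, mul_one, one_mul]
  exact Prod.ext
    (RingHom.congr_fun (Subsingleton.elim (ZMod.castHom (Nat.dvd_mul_right a b) (ZMod a))
      ((RingHom.fst _ _).comp (ZMod.chineseRemainder h).toRingHom)) (u : ZMod (a * b)))
    (RingHom.congr_fun (Subsingleton.elim (ZMod.castHom (Nat.dvd_mul_left b a) (ZMod b))
      ((RingHom.snd _ _).comp (ZMod.chineseRemainder h).toRingHom)) (u : ZMod (a * b)))

/-- Restriction of a Dirichlet character along a homomorphism of unit groups. -/
noncomputable def restrict {m n : ℕ} (f : (ZMod m)ˣ →* (ZMod n)ˣ) :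
    DirichletCharacter ℂ n →* DirichletCharacter ℂ m where
  toFun χ := MulChar.ofUnitHom (χ.toUnitHom.comp f)
  map_one' := by
    ext u
    rw [MulChar.ofUnitHom_coe, MonoidHom.comp_apply, MulChar.coe_toUnitHom, MulChar.one_apply_coe,
      MulChar.one_apply_coe]
  map_mul' χ ψ := by
    ext u
    simp only [MulChar.mul_apply, MulChar.ofUnitHom_coe, MonoidHom.comp_apply,
      MulChar.coe_toUnitHom]

theorem restrict_apply_coe {m n : ℕ} (f : (ZMod m)ˣ →* (ZMod n)ˣ) (χ : DirichletCharacter ℂ n)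
    (u : (ZMod m)ˣ) : restrict f χ u = χ (f u) := by
  simp only [restrict, MonoidHom.coe_mk, OneHom.coe_mk, MulChar.ofUnitHom_coe,
    MonoidHom.comp_apply, MulChar.coe_toUnitHom]

theorem changeLevel_restrict_mul (h : a.Coprime b) (χ : DirichletCharacter ℂ (a * b)) :
    changeLevel (Nat.dvd_mul_right a b) (restrict (unitsInl h) χ) *
      changeLevel (Nat.dvd_mul_left b a) (restrict (unitsInr h) χ) = χ := by
  ext u
  simp only [MulChar.mul_apply, changeLevel_def, MulChar.ofUnitHom_coe, MonoidHom.comp_apply,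
    MulChar.coe_toUnitHom, restrict_apply_coe]
  rw [← map_mul, ← Units.val_mul, unitsInl_mul_unitsInr]

/-- The conductor $ab$ divides the product of the conductors of the two components, which by
coprimality forces both to be primitive. -/
theorem ncard_primitiveTorsion_mul_le (p : ℕ) (h : a.Coprime b) (ha : a ≠ 0) (hb : b ≠ 0) :
    (primitiveTorsion p (a * b)).ncard ≤
      (primitiveTorsion p a).ncard * (primitiveTorsion p b).ncard := by
  have : NeZero a := ⟨ha⟩
  have : NeZero b := ⟨hb⟩
  have : NeZero (a * b) := ⟨mul_ne_zero ha hb⟩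
  rw [← Set.ncard_prod]
  refine Set.ncard_le_ncard_of_injOn (fun χ => (restrict (unitsInl h) χ, restrict (unitsInr h) χ)) ?_ ?_
    (Set.toFinite _)
  · rintro χ ⟨hprim, hχ⟩
    have hd := conductor_mul_dvd_lcm_conductor
      (changeLevel (Nat.dvd_mul_right a b) (restrict (unitsInl h) χ))
      (changeLevel (Nat.dvd_mul_left b a) (restrict (unitsInr h) χ))
    rw [changeLevel_restrict_mul, conductor_changeLevel, conductor_changeLevel,
      (isPrimitive_def _).mp hprim] at hd
    replace hd := hd.trans (Nat.lcm_dvd_mul _ _)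
    have h1 := conductor_dvd_level (restrict (unitsInl h) χ)
    have h2 := conductor_dvd_level (restrict (unitsInr h) χ)
    refine ⟨⟨?_, ?_⟩, ⟨?_, ?_⟩⟩
    · exact h1.antisymm ((h.coprime_dvd_right h2).dvd_of_dvd_mul_right
        ((Nat.dvd_mul_right a b).trans hd))
    · simp only
      rw [← map_pow, hχ, map_one]
    · exact h2.antisymm ((h.symm.coprime_dvd_right h1).dvd_of_dvd_mul_left
        ((Nat.dvd_mul_left b a).trans hd))
    · simp only
      rw [← map_pow, hχ, map_one]
  · intro χ _ ψ _ hχψ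
    simp only [Prod.mk.injEq] at hχψ
    rw [← changeLevel_restrict_mul h χ, ← changeLevel_restrict_mul h ψ, hχψ.1, hχψ.2]

end Coprime

theorem primitiveTorsion_one_ncard_le (p : ℕ) : (primitiveTorsion p 1).ncard ≤ 1 :=
  Set.ncard_le_one_of_subsingleton _

end DirichletCharacter

theorem evenPrimCount_le_ncard_primitiveTorsion (p : ℕ) {m : ℕ} (hm : m ≠ 0) :
    evenPrimCount p m ≤ (DirichletCharacter.primitiveTorsion p m).ncard := by
  have : NeZero m := ⟨hm⟩
  refine Set.ncard_le_ncard (fun χ hχ => ⟨hχ.2.1, ?_⟩) (Set.toFinite _)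
  rw [← hχ.2.2, pow_orderOf_eq_one]

/-! ### Counting ideals by norm. -/

open NumberField Ideal in
theorem NumberField.exists_sum_card_norm_le (K : Type*) [Field K] [NumberField K] :
    ∃ C : ℝ, 0 < C ∧ ∀ n : ℕ,
      (∑ m ∈ Finset.Icc 1 n, Nat.card {I : Ideal (𝓞 K) // absNorm I = m} : ℝ) ≤ C * n := by
  have h := (Ideal.tendsto_norm_le_div_atTop₀ K).comp tendsto_natCast_atTop_atTop
  have key : ∀ n : ℕ, (∑ m ∈ Finset.Icc 1 n, Nat.card {I : Ideal (𝓞 K) // absNorm I = m} : ℝ) =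
      (Nat.card {I : nonZeroDivisors (Ideal (𝓞 K)) // absNorm (I : Ideal (𝓞 K)) ≤ (n : ℝ)} : ℝ) := by
    intro n
    simp only [Nat.cast_le, ← Nat.cast_sum]
    congr
    -- The added 1 is the zero ideal, the only one of norm 0.
    rw [← add_left_inj 1, ← card_norm_le_eq_card_norm_le_add_one,
      show Finset.Icc 1 n = Finset.Ioc 0 n from Finset.Icc_succ_left_eq_Ioc _ _,
      show 1 = Nat.card {I : Ideal (𝓞 K) // absNorm I = 0} by simp [Ideal.absNorm_eq_zero_iff],
      Finset.sum_Ioc_add_eq_sum_Icc (n.zero_le),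
      ← Finset.card_preimage_eq_sum_card_image_eq (fun k _ ↦ finite_setOfPred_absNorm_eq k)]
    simp [Set.coe_eq_subtype]
  obtain ⟨C, hC⟩ := h.bddAbove_range
  refine ⟨max C 1, by positivity, fun n => ?_⟩
  rcases Nat.eq_zero_or_pos n with rfl | hn
  · simp
  · rw [key]
    have := hC ⟨n, rfl⟩
    simp only [Function.comp_apply] at this
    rw [div_le_iff₀ (by exact_mod_cast hn)] at this
    exact this.trans (by gcongr; exact le_max_left _ _)

open NumberField Ideal in
-- Multiplication of ideals is injective here: each ideal contains its norm, so ideals of coprime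
-- norms are coprime and the factors are recovered from the product.
theorem NumberField.card_norm_mul_le (K : Type*) [Field K] [NumberField K] {a b : ℕ}
    (h : a.Coprime b) (ha : a ≠ 0) :
    Nat.card {I : Ideal (𝓞 K) // absNorm I = a} * Nat.card {I : Ideal (𝓞 K) // absNorm I = b} ≤
      Nat.card {I : Ideal (𝓞 K) // absNorm I = a * b} := by
  have : Finite {I : Ideal (𝓞 K) // absNorm I = a * b} := finite_setOfPred_absNorm_eq (a * b)
  rw [← Nat.card_prod]
  have hdvd : ∀ I I' J J' : Ideal (𝓞 K), absNorm I = a → absNorm J' = b → I * J = I' * J' →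
      I ∣ I' := by
    intro I I' J J' hI hJ' e
    have hc : IsCoprime I J' := by
      rw [Ideal.isCoprime_iff_exists]
      obtain ⟨u, v, huv⟩ := Nat.isCoprime_iff_coprime.mpr h
      refine ⟨(u * a : ℤ), ?_, (v * b : ℤ), ?_, by exact_mod_cast congrArg (Int.cast : ℤ → 𝓞 K) huv⟩
      · push_cast
        exact I.mul_mem_left _ (hI ▸ absNorm_mem I)
      · push_cast
        exact J'.mul_mem_left _ (hJ' ▸ absNorm_mem J')
    exact hc.dvd_of_dvd_mul_right (e ▸ Dvd.intro J rfl)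
  refine Nat.card_le_card_of_injective
    (fun x => ⟨x.1.1 * x.2.1, by rw [map_mul, x.1.2, x.2.2]⟩) ?_
  rintro ⟨⟨I, hI⟩, ⟨J, hJ⟩⟩ ⟨⟨I', hI'⟩, ⟨J', hJ'⟩⟩ e
  simp only [Subtype.mk.injEq] at e
  have h1 : I = I' := dvd_antisymm (hdvd _ _ _ _ hI hJ' e) (hdvd _ _ _ _ hI' hJ e.symm)
  subst h1
  have hI0 : I ≠ 0 := by
    rintro rfl
    exact ha (by simpa using hI.symm)
  have h2 : J = J' := mul_left_cancel₀ hI0 e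
  subst h2
  rfl

open NumberField Ideal in
-- Since $q \equiv 1 \pmod p$, the prime $q$ splits completely.
theorem NumberField.pred_le_card_norm_cyclotomic {p q : ℕ} [Fact p.Prime] [Fact q.Prime]
    (hpq : p ∣ q - 1) (K : Type*) [Field K] [NumberField K] [IsCyclotomicExtension {p} ℚ K] :
    p - 1 ≤ Nat.card {I : Ideal (𝓞 K) // absNorm I = q} := by
  have hp : p.Prime := Fact.out
  have hq : q.Prime := Fact.out
  have hqp : ¬ q ∣ p := fun h => by
    have := Nat.le_of_dvd hp.pos h
    have := Nat.le_of_dvd (Nat.sub_pos_of_lt hq.one_lt) hpq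
    have := hq.pos
    omega
  have hord : orderOf (q : ZMod p) = 1 := by
    rw [orderOf_eq_one_iff]
    have h : ((q - 1 : ℕ) : ZMod p) = 0 := (ZMod.natCast_eq_zero_iff _ _).mpr hpq
    rw [Nat.cast_sub hq.one_lt.le, Nat.cast_one, sub_eq_zero] at h
    exact h
  have : IsGalois ℚ K := IsCyclotomicExtension.isGalois {p} ℚ K
  have hmax : (span {(q : ℤ)}).IsMaximal := Int.ideal_span_isMaximal_of_prime q
  have hmain := ncard_primesOver_mul_ramificationIdxIn_mul_inertiaDegIn
    (span {(q : ℤ)}) (𝓞 K) Gal(K/ℚ)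
  rw [IsCyclotomicExtension.Rat.inertiaDegIn_eq_of_not_dvd q K hqp,
    IsCyclotomicExtension.Rat.ramificationIdxIn_eq_of_not_dvd q K hqp, hord,
    IsGalois.card_aut_eq_finrank, IsCyclotomicExtension.Rat.finrank p, Nat.totient_prime hp,
    mul_one, mul_one] at hmain
  rw [← hmain]
  refine Set.ncard_le_ncard (t := {I : Ideal (𝓞 K) | absNorm I = q}) ?_
    (finite_setOfPred_absNorm_eq q)
  rintro P ⟨hP, hPo⟩
  have hPmax : P.IsMaximal := .of_liesOver_isMaximal P (span {(q : ℤ)})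
  have h1 := absNorm_eq_pow_inertiaDeg' P hq
  have h2 := IsCyclotomicExtension.Rat.inertiaDeg_eq_of_not_dvd q K P hqp
  rw [inertiaDeg'_eq_inertiaDeg, h2, hord, pow_one] at h1
  exact h1

open NumberField Ideal in
theorem NumberField.one_le_card_norm_one (K : Type*) [Field K] [NumberField K] :
    1 ≤ Nat.card {I : Ideal (𝓞 K) // absNorm I = 1} := by
  have : Finite {I : Ideal (𝓞 K) // absNorm I = 1} := finite_setOfPred_absNorm_eq 1
  have : Nonempty {I : Ideal (𝓞 K) // absNorm I = 1} := ⟨⟨⊤, absNorm_top⟩⟩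
  exact Nat.card_pos

/-! ### Sum against integral. -/

theorem intSum_eq_sum_range (r : ℝ) (g : ℝ → ℝ) {X : ℝ} (hX : ⌈r⌉ ≤ ⌊X⌋) :
    intSum r g X = ∑ i ∈ Finset.range ((⌊X⌋ - ⌈r⌉).toNat + 1), g (⌈r⌉ + i) := by
  unfold intSum
  symm
  refine Finset.sum_bij (fun i _ => ⌈r⌉ + (i : ℤ)) ?_ ?_ ?_ ?_
  · intro i hi
    simp only [Finset.mem_range, Finset.mem_Icc] at hi ⊢
    omega
  · intro i _ j _ h
    simpa using h
  · intro m hm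
    simp only [Finset.mem_Icc] at hm
    exact ⟨(m - ⌈r⌉).toNat, by simp only [Finset.mem_range]; omega, by omega⟩
  · intro i _
    push_cast
    rfl

section

variable {r : ℝ} {g : ℝ → ℝ}

theorem AntitoneOn.intervalIntegrable_of_le (hanti : AntitoneOn g (Set.Ici r)) {a b : ℝ}
    (ha : r ≤ a) (hb : r ≤ b) : IntervalIntegrable g MeasureTheory.volume a b :=
  (hanti.mono fun _ hx => (le_min ha hb).trans hx.1).intervalIntegrable

theorem abs_intSum_sub_integral_le (hpos : ∀ x, r ≤ x → 0 < g x)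
    (hanti : AntitoneOn g (Set.Ici r)) {X : ℝ} (hX : ⌈r⌉ ≤ ⌊X⌋) :
    |intSum r g X - ∫ t in r..X, g t| ≤ 2 * g r := by
  have hrc : r ≤ (⌈r⌉ : ℝ) := Int.le_ceil r
  have hcr : (⌈r⌉ : ℝ) ≤ r + 1 := (Int.ceil_lt_add_one r).le
  set n := (⌊X⌋ - ⌈r⌉).toNat with hn
  have hfl : (⌈r⌉ : ℝ) + n = ⌊X⌋ := by
    have : (n : ℤ) = ⌊X⌋ - ⌈r⌉ := by omega
    have : (n : ℝ) = ⌊X⌋ - ⌈r⌉ := by exact_mod_cast this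
    linarith
  have hXf : (⌊X⌋ : ℝ) ≤ X := Int.floor_le X
  have hXf' : X ≤ ⌊X⌋ + 1 := (Int.lt_floor_add_one X).le
  have hrf : r ≤ (⌊X⌋ : ℝ) := hrc.trans (by exact_mod_cast hX)
  -- Used for the two fractional end pieces, each costing at most $g(r)$.
  have hI : ∀ a b : ℝ, r ≤ a → a ≤ b → b ≤ a + 1 →
      0 ≤ ∫ t in a..b, g t ∧ ∫ t in a..b, g t ≤ g r := by
    intro a b ha hab hb
    refine ⟨intervalIntegral.integral_nonneg hab fun x hx => (hpos x (ha.trans hx.1)).le, ?_⟩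
    have h1 : ∫ t in a..b, g t ≤ ∫ t in a..b, g r :=
      intervalIntegral.integral_mono_on hab (hanti.intervalIntegrable_of_le ha (ha.trans hab))
        intervalIntegrable_const
        fun x hx => hanti Set.self_mem_Ici (ha.trans hx.1) (ha.trans hx.1)
    rw [intervalIntegral.integral_const, smul_eq_mul] at h1
    have := hpos r le_rfl
    nlinarith
  obtain ⟨hA0, hA1⟩ := hI r ⌈r⌉ le_rfl hrc hcr
  obtain ⟨hB0, hB1⟩ := hI ⌊X⌋ X hrf hXf hXf'
  have hsplit : ∫ t in r..X, g t = (∫ t in r..(⌈r⌉ : ℝ), g t) +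
      (∫ t in (⌈r⌉ : ℝ)..⌊X⌋, g t) + ∫ t in (⌊X⌋ : ℝ)..X, g t := by
    rw [intervalIntegral.integral_add_adjacent_intervals,
      intervalIntegral.integral_add_adjacent_intervals] <;>
    exact hanti.intervalIntegrable_of_le (by linarith) (by linarith)
  have hanti' : AntitoneOn g (Set.Icc (⌈r⌉ : ℝ) (⌈r⌉ + n)) :=
    hanti.mono fun x hx => hrc.trans hx.1
  have hlow := hanti'.integral_le_sum
  have hup := hanti'.sum_le_integral
  rw [hfl] at hlow hup
  have hs := intSum_eq_sum_range r g hX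
  have hs1 := hs
  rw [← hn, Finset.sum_range_succ] at hs
  rw [← hn, Finset.sum_range_succ'] at hs1
  have hgn : 0 < g (⌈r⌉ + n) := hpos _ (by rw [hfl]; exact hrf)
  have hgn' : g (⌈r⌉ + n) ≤ g r :=
    hanti Set.self_mem_Ici (by rw [hfl]; exact hrf) (by rw [hfl]; exact hrf)
  have hg0 : g (⌈r⌉ + (0 : ℕ)) ≤ g r := by
    rw [Nat.cast_zero, add_zero]
    exact hanti Set.self_mem_Ici hrc hrc
  rw [abs_le]
  constructor <;> linarith

theorem intSum_mono (hpos : ∀ x, r ≤ x → 0 < g x) : Monotone (intSum r g) := by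
  intro X Y h
  refine Finset.sum_le_sum_of_subset_of_nonneg
    (Finset.Icc_subset_Icc le_rfl (Int.floor_mono h)) fun m hm _ => ?_
  exact (hpos _ (Int.ceil_le.mp (Finset.mem_Icc.mp hm).1)).le

theorem asympProportional_intSum_integral (hpos : ∀ x, r ≤ x → 0 < g x)
    (hanti : AntitoneOn g (Set.Ici r)) :
    AsympProportional (intSum r g) (fun X => ∫ t in r..X, g t) := by
  set J : ℝ → ℝ := fun X => ∫ t in r..X, g t with hJ
  have hJmono : MonotoneOn J (Set.Ici r) := by
    intro a ha b hb hab
    have h1 : J a + ∫ t in a..b, g t = J b :=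
      intervalIntegral.integral_add_adjacent_intervals
        (hanti.intervalIntegrable_of_le le_rfl ha) (hanti.intervalIntegrable_of_le ha hb)
    have h2 : 0 ≤ ∫ t in a..b, g t :=
      intervalIntegral.integral_nonneg hab fun x hx =>
        (hpos x ((Set.mem_Ici.mp ha).trans hx.1)).le
    linarith
  have hlarge : ∀ᶠ X : ℝ in atTop, ⌈r⌉ ≤ ⌊X⌋ := by
    filter_upwards [eventually_ge_atTop (⌈r⌉ : ℝ)] with X hX
    exact Int.le_floor.mpr hX
  have hdiff : ∀ᶠ X in atTop, |intSum r g X - J X| ≤ 2 * g r :=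
    hlarge.mono fun X hX => abs_intSum_sub_integral_le hpos hanti hX
  have hJpos : ∀ X, r < X → 0 < J X := fun X hX =>
    intervalIntegral.intervalIntegral_pos_of_pos_on
      (hanti.intervalIntegrable_of_le le_rfl hX.le) (fun x hx => hpos x hx.1.le) hX
  -- Truncating at $r$ makes the integral monotone on all of $\mathbb{R}$, so it diverges or
  -- converges.
  have hJmono' : Monotone fun X => J (max r X) := fun a b hab =>
    hJmono (Set.mem_Ici.mpr (le_max_left _ _)) (Set.mem_Ici.mpr (le_max_left _ _))
      (max_le_max le_rfl hab)
  have hJeq : (fun X => J (max r X)) =ᶠ[atTop] J := by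
    filter_upwards [eventually_ge_atTop r] with X hX
    rw [max_eq_right hX]
  rcases tendsto_atTop_of_monotone hJmono' with hJtop | ⟨L, hL⟩
  · refine ⟨1, one_ne_zero, ?_⟩
    have hJtop' : Tendsto J atTop atTop := hJtop.congr' hJeq
    have h0 : Tendsto (fun X => (intSum r g X - J X) / J X) atTop (𝓝 0) := by
      refine squeeze_zero_norm' (a := fun X => 2 * g r / J X) ?_ (hJtop'.const_div_atTop _)
      filter_upwards [hdiff, eventually_gt_atTop r] with X h1 h2
      rw [norm_div, Real.norm_eq_abs, Real.norm_of_nonneg (hJpos X h2).le]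
      exact div_le_div_of_nonneg_right h1 (hJpos X h2).le
    have h1 := h0.add_const 1
    rw [zero_add] at h1
    refine h1.congr' ?_
    filter_upwards [eventually_gt_atTop r] with X hX
    have := (hJpos X hX).ne'
    simp only [hJ] at this ⊢
    field_simp
    ring
  · have hLpos : 0 < L := (hJpos (r + 1) (by linarith)).trans_le (by
      have := hJmono'.ge_of_tendsto hL (r + 1)
      simpa [max_eq_right (show r ≤ r + 1 by linarith)] using this)
    have hLJ : Tendsto J atTop (𝓝 L) := hL.congr' hJeq
    rcases tendsto_atTop_of_monotone (intSum_mono (g := g) hpos) with htop | ⟨M, hM⟩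
    · exfalso
      have h1 : ∀ᶠ X in atTop, intSum r g X ≤ L + 1 + 2 * g r := by
        filter_upwards [hdiff, hLJ.eventually_le_const (show L < L + 1 by linarith)] with X h1 h2
        have := (abs_le.mp h1).2
        linarith
      obtain ⟨X, h1, h2⟩ := (h1.and (htop.eventually_gt_atTop (L + 1 + 2 * g r))).exists
      linarith
    · have hMpos : 0 < M := by
        have h1 := (intSum_mono (g := g) hpos).ge_of_tendsto hM (⌈r⌉ : ℝ)
        have h2 : intSum r g (⌈r⌉ : ℝ) = g ⌈r⌉ := by simp [intSum]
        rw [h2] at h1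
        exact (hpos _ (Int.le_ceil r)).trans_le h1
      exact ⟨M / L, (div_pos hMpos hLpos).ne', hM.div hLJ hLpos.ne'⟩

end

/-! ### Comparing characters with ideals, and the mean value bound. -/

section Counting

open NumberField

/-- The number of ideals of norm `m` in the ring of integers of `K`. -/
noncomputable def idealCount (K : Type*) [Field K] [NumberField K] (m : ℕ) : ℕ :=
  Nat.card {I : Ideal (𝓞 K) // Ideal.absNorm I = m}

variable {p : ℕ} [Fact p.Prime] (K : Type*) [Field K] [NumberField K]
  [IsCyclotomicExtension {p} ℚ K]

open DirichletCharacter in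
theorem ncard_primitiveTorsion_le_idealCount {m : ℕ} (hm : m ≠ 0) (hpm : ¬ p ∣ m) :
    (primitiveTorsion p m).ncard ≤ idealCount K m := by
  have hp : p.Prime := Fact.out
  induction m using Nat.recOnPrimeCoprime with
  | zero => exact absurd rfl hm
  | prime_pow q k hq =>
    have : Fact q.Prime := ⟨hq⟩
    rcases k with _ | _ | k
    · rw [pow_zero]
      exact (primitiveTorsion_one_ncard_le p).trans (one_le_card_norm_one K)
    · rw [zero_add, pow_one]
      by_cases hpq : p ∣ q - 1
      · exact (ncard_primitiveTorsion_prime_le hp hq).trans (pred_le_card_norm_cyclotomic hpq K)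
      · rw [primitiveTorsion_prime_eq_empty hp hq hpq, Set.ncard_empty]
        exact Nat.zero_le _
    · rw [primitiveTorsion_prime_pow_eq_empty hp hq ?_ (by omega), Set.ncard_empty]
      · exact Nat.zero_le _
      · rintro rfl
        exact hpm (dvd_pow_self p (by omega))
  | coprime a b ha hb hab iha ihb =>
    have ha0 : a ≠ 0 := by omega
    have hb0 : b ≠ 0 := by omega
    calc (primitiveTorsion p (a * b)).ncard
        ≤ (primitiveTorsion p a).ncard * (primitiveTorsion p b).ncard :=
          ncard_primitiveTorsion_mul_le p hab ha0 hb0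
      _ ≤ idealCount K a * idealCount K b :=
          Nat.mul_le_mul (iha ha0 fun h => hpm (h.mul_right b))
            (ihb hb0 fun h => hpm (h.mul_left a))
      _ ≤ idealCount K (a * b) := card_norm_mul_le K hab ha0

theorem evenPrimCount_le_idealCount {m : ℕ} (hm : m ≠ 0) :
    evenPrimCount p m ≤ p ^ 2 * idealCount K (ordCompl[p] m) := by
  have hp : p.Prime := Fact.out
  refine (evenPrimCount_le_ncard_primitiveTorsion p hm).trans ?_
  have hc : (ordCompl[p] m) ≠ 0 := (Nat.ordCompl_pos p hm).ne'
  conv_lhs => rw [← Nat.ordProj_mul_ordCompl_eq_self m p]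
  refine (DirichletCharacter.ncard_primitiveTorsion_mul_le p
    ((Nat.coprime_ordCompl hp hm).pow_left _) (pow_ne_zero _ hp.ne_zero) hc).trans ?_
  exact Nat.mul_le_mul (DirichletCharacter.ncard_primitiveTorsion_prime_pow_self_le hp _)
    (ncard_primitiveTorsion_le_idealCount K hc (Nat.not_dvd_ordCompl hp hm))

end Counting

/-- Terms prime to $p$ contribute at most $Cn$; multiples of $p$ reproduce the sum up to $n/p \le
n/2$, hence the factor 2. -/
theorem sum_ordCompl_le {p : ℕ} (hp : p.Prime) {a : ℕ → ℝ} (ha : ∀ m, 0 ≤ a m) {C : ℝ}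
    (hC : ∀ n : ℕ, ∑ m ∈ Finset.Icc 1 n, a m ≤ C * n) (n : ℕ) :
    ∑ m ∈ Finset.Icc 1 n, a (ordCompl[p] m) ≤ 2 * C * n := by
  induction n using Nat.strong_induction_on with
  | _ n ih =>
  rcases Nat.eq_zero_or_pos n with rfl | hn
  · simp
  have hC0 : 0 ≤ C := by
    have h := hC 1
    simp only [Finset.Icc_self, Finset.sum_singleton, Nat.cast_one, mul_one] at h
    exact (ha 1).trans h
  rw [← Finset.sum_filter_add_sum_filter_not _ (fun m => p ∣ m)]
  have h1 : ∑ m ∈ Finset.Icc 1 n with ¬ p ∣ m, a (ordCompl[p] m) ≤ C * n := by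
    refine le_trans ?_ (hC n)
    rw [Finset.sum_congr rfl (g := a) fun m hm => by
      rw [Nat.factorization_eq_zero_of_not_dvd (Finset.mem_filter.mp hm).2, pow_zero, Nat.div_one]]
    exact Finset.sum_le_sum_of_subset_of_nonneg (Finset.filter_subset _ _) fun m _ _ => ha m
  have h2 : ∑ m ∈ Finset.Icc 1 n with p ∣ m, a (ordCompl[p] m) =
      ∑ k ∈ Finset.Icc 1 (n / p), a (ordCompl[p] k) := by
    symm
    refine Finset.sum_bij (fun k _ => p * k) ?_ ?_ ?_ ?_
    · intro k hk
      simp only [Finset.mem_Icc, Finset.mem_filter] at hk ⊢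
      exact ⟨⟨Nat.mul_pos hp.pos hk.1,
        (Nat.mul_le_mul_left p hk.2).trans (Nat.mul_div_le n p)⟩, dvd_mul_right p k⟩
    · intro i _ j _ h
      exact Nat.eq_of_mul_eq_mul_left hp.pos h
    · intro m hm
      simp only [Finset.mem_Icc, Finset.mem_filter] at hm
      obtain ⟨⟨hm1, hm2⟩, k, rfl⟩ := hm
      refine ⟨k, ?_, rfl⟩
      rw [Finset.mem_Icc, Nat.le_div_iff_mul_le hp.pos, mul_comm k p]
      exact ⟨Nat.pos_of_mul_pos_left hm1, hm2⟩
    · intro k hk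
      rw [Nat.ordCompl_mul, hp.factorization_self, pow_one, Nat.div_self hp.pos, one_mul]
  have h3 := ih (n / p) (Nat.div_lt_self hn hp.one_lt)
  have h4 : ((n / p : ℕ) : ℝ) ≤ n / 2 := by
    refine Nat.cast_div_le.trans ?_
    gcongr
    exact_mod_cast hp.two_le
  have h5 : 2 * C * ((n / p : ℕ) : ℝ) ≤ 2 * C * (n / 2) := by gcongr
  rw [h2]
  linarith

theorem exists_sum_evenPrimCount_le {p : ℕ} (hp : p.Prime) :
    ∃ C : ℝ, 0 < C ∧ ∀ n : ℕ, (∑ m ∈ Finset.Icc 1 n, evenPrimCount p m : ℝ) ≤ C * n := by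
  have : Fact p.Prime := ⟨hp⟩
  have : IsCyclotomicExtension {p} ℚ (CyclotomicField p ℚ) :=
    CyclotomicField.isCyclotomicExtension p ℚ
  obtain ⟨C, hC0, hC⟩ := NumberField.exists_sum_card_norm_le (CyclotomicField p ℚ)
  refine ⟨p ^ 2 * (2 * C), by have := hp.pos; positivity, fun n => ?_⟩
  have h := sum_ordCompl_le hp (a := fun m => (idealCount (CyclotomicField p ℚ) m : ℝ))
    (fun m => Nat.cast_nonneg _) hC n
  calc (∑ m ∈ Finset.Icc 1 n, evenPrimCount p m : ℝ)
      ≤ ∑ m ∈ Finset.Icc 1 n,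
          (p : ℝ) ^ 2 * idealCount (CyclotomicField p ℚ) (ordCompl[p] m) := by
        refine Finset.sum_le_sum fun m hm => ?_
        have hm0 : m ≠ 0 := by have := (Finset.mem_Icc.mp hm).1; omega
        exact_mod_cast evenPrimCount_le_idealCount (p := p) (CyclotomicField p ℚ) hm0
    _ ≤ p ^ 2 * (2 * C) * n := by
        rw [← Finset.mul_sum, mul_assoc]
        gcongr

/-! ### Abel summation and conclusion. -/

theorem sum_mul_nonneg_of_antitone {h G : ℕ → ℝ} (hG : Antitone G) (hG0 : ∀ i, 0 ≤ G i)
    (hh : ∀ n, 0 ≤ ∑ i ∈ Finset.range n, h i) (n : ℕ) :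
    0 ≤ ∑ i ∈ Finset.range n, h i * G i := by
  -- Nonnegativity alone does not pass through the induction; this stronger bound does.
  have key : ∀ n, G n * ∑ i ∈ Finset.range (n + 1), h i ≤
      ∑ i ∈ Finset.range (n + 1), h i * G i := by
    intro n
    induction n with
    | zero => simp [mul_comm]
    | succ n ih =>
      rw [Finset.sum_range_succ _ (n + 1), Finset.sum_range_succ _ (n + 1)]
      have := mul_le_mul_of_nonneg_right (hG (Nat.le_succ n)) (hh (n + 1))
      simp only [Nat.succ_eq_add_one] at this
      linarith
  rcases n with _ | n
  · simp
  · exact (mul_nonneg (hG0 n) (hh (n + 1))).trans (key n)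

theorem sum_mul_le_of_antitone {f G : ℕ → ℝ} {C : ℝ} (hG : Antitone G) (hG0 : ∀ i, 0 ≤ G i)
    (hf : ∀ n : ℕ, ∑ i ∈ Finset.range n, f i ≤ C * n) (n : ℕ) :
    ∑ i ∈ Finset.range n, f i * G i ≤ C * ∑ i ∈ Finset.range n, G i := by
  have h := sum_mul_nonneg_of_antitone (h := fun i => C - f i) hG hG0 (fun n => by
    rw [Finset.sum_sub_distrib, Finset.sum_const, Finset.card_range, nsmul_eq_mul, mul_comm]
    linarith [hf n]) n
  simp only [sub_mul, Finset.sum_sub_distrib, ← Finset.mul_sum] at h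
  linarith

theorem exists_charSum_le {r : ℝ} {g : ℝ → ℝ} (hpos : ∀ x, r ≤ x → 0 < g x)
    (hanti : AntitoneOn g (Set.Ici r)) {p : ℕ} (hp : p.Prime) :
    ∃ C : ℝ, 0 < C ∧ ∀ X : ℝ, r ≤ X → charSum p r g X ≤ C * intSum r g X := by
  obtain ⟨C, hC0, hC⟩ := exists_sum_evenPrimCount_le hp
  set a := max 1 ⌈r⌉₊ with ha
  have ha1 : 1 ≤ a := le_max_left _ _
  have har : r ≤ (a : ℝ) := (Nat.le_ceil r).trans (by exact_mod_cast le_max_right _ _)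
  have hari : ∀ i : ℕ, r ≤ ((a + i : ℕ) : ℝ) := fun i =>
    har.trans (by exact_mod_cast Nat.le_add_right a i)
  -- The factor $a$ absorbs the shifted start of the sum: $a + n \le a(n+1)$ because $a \ge 1$.
  refine ⟨C * a, by positivity, fun X _ => ?_⟩
  have hf : ∀ n : ℕ, ∑ i ∈ Finset.range n, (evenPrimCount p (a + i) : ℝ) ≤ C * a * n := by
    intro n
    rcases n with _ | n
    · simp
    have h1 : ∑ i ∈ Finset.range (n + 1), (evenPrimCount p (a + i) : ℝ) =
        ∑ m ∈ Finset.Ico a (a + (n + 1)), (evenPrimCount p m : ℝ) := by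
      rw [Finset.sum_Ico_eq_sum_range, Nat.add_sub_cancel_left]
    have h2 : ∑ m ∈ Finset.Ico a (a + (n + 1)), (evenPrimCount p m : ℝ) ≤
        ∑ m ∈ Finset.Icc 1 (a + n), (evenPrimCount p m : ℝ) := by
      refine Finset.sum_le_sum_of_subset_of_nonneg (fun m hm => ?_)
        fun _ _ _ => Nat.cast_nonneg _
      simp only [Finset.mem_Ico, Finset.mem_Icc] at hm ⊢
      omega
    have h3 : ((a + n : ℕ) : ℝ) ≤ a * (n + 1 : ℕ) := by
      have : a + n ≤ a * (n + 1) := by nlinarith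
      exact_mod_cast this
    calc ∑ i ∈ Finset.range (n + 1), (evenPrimCount p (a + i) : ℝ)
        ≤ C * (a + n : ℕ) := h1.le.trans (h2.trans (hC _))
      _ ≤ C * (a * (n + 1 : ℕ)) := by gcongr
      _ = C * a * (n + 1 : ℕ) := by ring
  have hanti' : Antitone fun i : ℕ => g ((a + i : ℕ) : ℝ) := fun i j hij =>
    hanti (hari i) (hari j) (by exact_mod_cast Nat.add_le_add_left hij a)
  have hIco : Finset.Icc a ⌊X⌋₊ = Finset.Ico a (⌊X⌋₊ + 1) := by
    ext m
    simp only [Finset.mem_Icc, Finset.mem_Ico]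
    omega
  have h := sum_mul_le_of_antitone hanti' (fun i => (hpos _ (hari i)).le) hf (⌊X⌋₊ + 1 - a)
  rw [← Finset.sum_Ico_eq_sum_range (fun m : ℕ => g (m : ℝ)) a (⌊X⌋₊ + 1),
    ← Finset.sum_Ico_eq_sum_range (fun m : ℕ => (evenPrimCount p m : ℝ) * g (m : ℝ)) a
      (⌊X⌋₊ + 1), ← hIco] at h
  refine h.trans (mul_le_mul_of_nonneg_left ?_ (by positivity))
  have hmap : ∑ m ∈ Finset.Icc a ⌊X⌋₊, g (m : ℝ) =
      ∑ m ∈ (Finset.Icc a ⌊X⌋₊).map Nat.castEmbedding, g ((m : ℤ) : ℝ) := by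
    simp
  rw [hmap]
  refine Finset.sum_le_sum_of_subset_of_nonneg (fun m hm => ?_) fun m hm _ =>
    (hpos _ (Int.ceil_le.mp (Finset.mem_Icc.mp hm).1)).le
  simp only [Finset.mem_map, Finset.mem_Icc, Nat.castEmbedding_apply] at hm ⊢
  obtain ⟨k, ⟨hk1, hk2⟩, rfl⟩ := hm
  constructor
  · rw [Int.ceil_le]
    exact har.trans (by exact_mod_cast hk1)
  · rw [Int.le_floor]
    exact_mod_cast (Nat.le_floor_iff' (by omega)).mp hk2

theorem mainTheorem6 (r : ℝ) (g : ℝ → ℝ)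
    (hpos : ∀ x, r ≤ x → 0 < g x)
    (hanti : AntitoneOn g (Set.Ici r))
    (hC1 : ContDiffOn ℝ 1 g (Set.Ici r))
    (hderiv : (fun X => -deriv g X) =O[atTop] (fun X => g X / X)) :
    (∀ p : ℕ, p.Prime →
      ∃ C : ℝ, 0 < C ∧ ∀ X : ℝ, r ≤ X → charSum p r g X ≤ C * intSum r g X) ∧
    AsympProportional (intSum r g) (fun X => ∫ t in r..X, g t) :=
  ⟨fun _ hp => exists_charSum_le hpos hanti hp, asympProportional_intSum_integral hpos hanti⟩
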